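/- For a finite connected simple graph $G$ with vertex set $V$ and edge set $E$, let the adjacency polytope (symmetric edge polytope) of $G$ be $$\operatorname{conv}(\bar\nabla_G),\qquad \bar\nabla_G=\{\pm(\mathbf e_i-\mathbf e_j)\mid \{i,j\}\in E\}\subset\mathbb R^{V},$$ or, in its full-dimensional form with respect to a reference vertex $r\in V$, the convex hull $\operatorname{conv}(\check\nabla_G)\subset\mathbb R^{V\setminus\{r\}}$ of the same points with the convention $\mathbf e_r=\mathbf 0$. Write $|\mathcal F(\nabla_G)|$ for the number of facets (maximal proper faces) of this polytope, where $\nabla_G$ may be read as $\bar\nabla_G$ or as $\check\nabla_G$ (for any choice of reference vertices). Let $C_n$ denote the cycle of length $n\ge 3$, and let $C_2$ denote the graph with two vertices joined by a single edge. Write $f_{C_n}=|\mathcal F(\nabla_{C_n})|$. Let $m_1\ge 2$ and $m_2\ge 1$ be integers, and let $G$ be the graph formed by joining a cycle of length $2m_1$ and a cycle of length $2m_2+1$ along a shared edge; that is, $G$ is the union of the two cycles, which have exactly two vertices in common, and these two vertices are joined by an edge that belongs to both cycles. Then $$|\mathcal F(\nabla_G)|=\frac{m_1+2m_2}{2}\,f_{C_{2m_1}}\,f_{C_{2m_2}}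 .$$ -/

import Mathlib

/-- A facet of a convex polytope `P`: a maximal element among the proper faces of `P`.
The faces of `P` are the empty set and the nonempty sets of points of `P` at which some linear
functional is optimal over `P`; the zero functional gives `P` itself. (Mathlib's `IsExposed` speaks
of maximizing `l`, which is the same as minimizing `-l`.) -/
def IsPolytopeFacet {E : Type*} [AddCommGroup E] [Module ℝ E] [TopologicalSpace E]
    (P F : Set E) : Prop :=
  Maximal (fun B : Set E => IsExposed ℝ P B ∧ B ≠ P) F

/-- The number `|𝓕(P)|` of facets of a convex polytope `P`. -/
noncomputable def numFacets {E : Type*} [AddCommGroup E] [Module ℝ E] [TopologicalSpace E]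
    (P : Set E) : ℕ :=
  {F : Set E | IsPolytopeFacet P F}.ncard

namespace SimpleGraph

/-- The adjacency polytope (symmetric edge polytope) of `G`, in the ambient space `ℝ^V`: the convex
hull of the points `±(e_i - e_j)`, for the edges `{i, j}` of `G`. Both signs occur, because
adjacency is symmetric. -/
def adjacencyPolytope {V : Type*} [DecidableEq V] (G : SimpleGraph V) : Set (V → ℝ) :=
  convexHull ℝ {x | ∃ i j : V, G.Adj i j ∧ x = Pi.single i 1 - Pi.single j 1}

/-- The vector `e_i` of `ℝ^(V ∖ {r})`, where `e_r = 0`. -/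
def reducedBasisVector {V : Type*} [DecidableEq V] (r i : V) : {v : V // v ≠ r} → ℝ :=
  fun v => if v.1 = i then 1 else 0

/-- The full-dimensional form of the adjacency polytope: with a vertex `r` as reference, the convex
hull in `ℝ^(V ∖ {r})` of the points `±(e_i - e_j)`, for the edges `{i, j}` of `G`, where
`e_r = 0`. -/
def reducedAdjacencyPolytope {V : Type*} [DecidableEq V] (G : SimpleGraph V) (r : V) :
    Set ({v : V // v ≠ r} → ℝ) :=
  convexHull ℝ
    {x | ∃ i j : V, G.Adj i j ∧ x = reducedBasisVector r i - reducedBasisVector r j}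

/-- `G` is formed by joining `H₁` and `H₂` along a shared edge: `G` is the union of a copy of `H₁`
and a copy of `H₂` that have exactly two vertices in common, and these two vertices span an edge
in both copies. -/
def IsEdgeJoin {V V₁ V₂ : Type*} (G : SimpleGraph V) (H₁ : SimpleGraph V₁)
    (H₂ : SimpleGraph V₂) : Prop :=
  ∃ (f : V₁ ↪ V) (g : V₂ ↪ V) (a b : V₁) (c d : V₂),
    H₁.Adj a b ∧ H₂.Adj c d ∧ f a = g c ∧ f b = g d ∧
    Set.range f ∩ Set.range g = {f a, f b} ∧
    Set.range f ∪ Set.range g = Set.univ ∧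
    G = H₁.map f ⊔ H₂.map g

end SimpleGraph

/-! A supporting functional of the polytope, scaled to have maximum 1, is a height function on the
vertices that changes by at most 1 along every edge; its face is spanned by the edges along which
the change is exactly 1, the tight ones. The face is a facet exactly when the tight edges connect
all vertices: otherwise a component of the tight graph can be raised until a further edge becomes
tight, while a connected tight graph determines the heights up to a constant. So the facets of
either form of the polytope are counted by integral heights that vanish at a root
(`exists_facetHeight_of_le`, `numFacets_edgePolytope`).

Around a cycle the increments 0, ±1 sum to zero, so the number of tight edges is even. In a cycle of
length 2m connectedness allows at most one flat edge, parity then allows none, and choosing the m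
rises gives `m.centralBinom`. The single edge C₂ follows the same formula.

In G the shared edge joins the ends of two paths with k = 2m₁ - 1 and l = 2m₂ edges. There are k + l
vertices and k + l + 1 edges, so at most two edges are flat. Parity on both cycles leaves two cases:
the shared edge and one edge of the first path are flat, or just one edge of the second path is.
Writing f₁, f₂ for the central binomials of m₁, m₂, the first case contributes (2m₁ - 1) C(2m₁ - 2,
m₁ - 1) f₂ = (m₁/2) f₁ f₂. The second, with the shared edge rising or falling, contributes 2 ·
(f₁/2) · 2m₂ · (f₂/2) = m₂ f₁ f₂. -/

namespace SimpleGraph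

/-! ### Height functions and their tight graphs -/

/-- The spanning subgraph of `G` of the edges along which `h` changes by exactly one. -/
def tightGraph {V R : Type*} [CommRing R] [LinearOrder R] (G : SimpleGraph V) (h : V → R) :
    SimpleGraph V where
  Adj i j := G.Adj i j ∧ |h i - h j| = 1
  symm := ⟨fun i j hij => ⟨hij.1.symm, by rw [abs_sub_comm]; exact hij.2⟩⟩
  loopless := ⟨fun i hi => hi.1.ne rfl⟩

/-- The integral height functions that vanish at `r`, change by at most one along every edge, and
whose tight edges form a connected spanning subgraph. -/
def facetHeights {V : Type*} (G : SimpleGraph V) (r : V) : Set (V → ℤ) :=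
  {h | h r = 0 ∧ (∀ i j, G.Adj i j → h i - h j ≤ 1) ∧ (G.tightGraph h).Connected}

theorem eq_of_reachable {V α : Type*} {T : SimpleGraph V} {g : V → α}
    (hg : ∀ i j, T.Adj i j → g i = g j) {u v : V} (huv : T.Reachable u v) : g u = g v := by
  obtain ⟨w⟩ := huv
  induction w with
  | nil => rfl
  | cons h _ ih => exact (hg _ _ h).trans ih

theorem exists_adj_boundary {V : Type*} {G : SimpleGraph V} (hG : G.Connected) {C : Set V} {u v : V}
    (hu : u ∈ C) (hv : v ∉ C) : ∃ i j, G.Adj i j ∧ i ∈ C ∧ j ∉ C := by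
  obtain ⟨w⟩ := hG.preconnected u v
  obtain ⟨d, -, h1, h2⟩ := w.exists_boundary_dart C hu hv
  exact ⟨d.fst, d.snd, d.adj, h1, h2⟩

/-- A height function whose tight graph is connected is integral up to a constant. -/
theorem exists_int_height {V : Type*} {G : SimpleGraph V} (r : V) {h : V → ℝ}
    (hc : (G.tightGraph h).Connected) : ∃ k : V → ℤ, ∀ v, (k v : ℝ) = h v - h r := by
  have key : ∀ v, ∃ z : ℤ, (z : ℝ) = h v - h r := by
    intro v
    obtain ⟨w⟩ := hc.preconnected v r
    induction w with
    | nil => exact ⟨0, by simp⟩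
    | cons hadj _ ih =>
      obtain ⟨z, hz⟩ := ih
      rcases (abs_eq (zero_le_one' ℝ)).1 hadj.2 with h1 | h1
      · exact ⟨z + 1, by push_cast; linarith⟩
      · exact ⟨z - 1, by push_cast; linarith⟩
  choose k hk using key
  exact ⟨k, hk⟩

/-- No tight edge leaves a component C of a disconnected tight graph. Raising C by the least slack
among the edges leaving it keeps every tight edge tight, violates no bound and makes a new edge
tight, so induction on the number of non-tight oriented edges ends at a connected tight graph. In
polytope terms, every proper face lies in a face given by a facet height. -/
theorem exists_facetHeight_of_le {V : Type*} [Finite V] {G : SimpleGraph V} (hG : G.Connected)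
    (r : V) (h : V → ℝ) (hle : ∀ i j, G.Adj i j → h i - h j ≤ 1) :
    ∃ k ∈ G.facetHeights r, ∀ i j, G.Adj i j → h i - h j = 1 → k i - k j = 1 := by
  classical
  induction hn : {e : V × V | G.Adj e.1 e.2 ∧ h e.1 - h e.2 ≠ 1}.ncard using
    Nat.strong_induction_on generalizing h with
  | _ n ih =>
  by_cases hc : (G.tightGraph h).Connected
  · obtain ⟨k, hk⟩ := exists_int_height r hc
    have hsub : ∀ i j, ((k i - k j : ℤ) : ℝ) = h i - h j := by
      intro i j; push_cast; rw [hk, hk]; ring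
    refine ⟨k, ⟨?_, ?_, ?_⟩, ?_⟩
    · have := hk r
      rw [sub_self] at this
      exact_mod_cast this
    · intro i j hij
      have := hle i j hij
      rw [← hsub] at this
      exact_mod_cast this
    · convert hc using 1
      ext i j
      simp only [tightGraph, ← hsub]
      norm_cast
    · intro i j _ h1
      rw [← hsub] at h1
      exact_mod_cast h1
  · have hpre : ¬ (G.tightGraph h).Preconnected := fun hp =>
      hc ((connected_iff _).2 ⟨hp, ⟨r⟩⟩)
    simp only [Preconnected, not_forall] at hpre
    obtain ⟨u, v, huv⟩ := hpre
    set C : Set V := {w | (G.tightGraph h).Reachable u w} with hC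
    have hCadj : ∀ i j, G.Adj i j → h i - h j = 1 → (i ∈ C ↔ j ∈ C) := by
      intro i j hij h1
      have hadj : (G.tightGraph h).Adj i j := ⟨hij, by rw [h1, abs_one]⟩
      exact ⟨fun hi => hi.trans hadj.reachable, fun hj => hj.trans hadj.symm.reachable⟩
    obtain ⟨i₁, j₁, hij₁, hi₁, hj₁⟩ :=
      exists_adj_boundary hG (C := C) (Reachable.refl u) (show v ∉ C from huv)
    obtain ⟨⟨i₀, j₀⟩, ⟨hij₀, hi₀, hj₀⟩, hmin⟩ :=
      Set.exists_min_image {e : V × V | G.Adj e.1 e.2 ∧ e.1 ∈ C ∧ e.2 ∉ C}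
        (fun e => 1 - (h e.1 - h e.2)) (Set.toFinite _) ⟨(i₁, j₁), hij₁, hi₁, hj₁⟩
    simp only at hij₀ hi₀ hj₀ hmin
    set t := 1 - (h i₀ - h j₀) with ht
    have hne : h i₀ - h j₀ ≠ 1 := fun h1 => hj₀ ((hCadj _ _ hij₀ h1).1 hi₀)
    have ht0 : 0 < t := by
      have := lt_of_le_of_ne (hle _ _ hij₀) hne
      linarith
    let h' : V → ℝ := fun w => h w + if w ∈ C then t else 0
    have hkeep : ∀ i j, G.Adj i j → h i - h j = 1 → h' i - h' j = 1 := by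
      intro i j hij h1
      have := hCadj i j hij h1
      by_cases hi : i ∈ C
      · simp only [h', hi, this.1 hi, if_true]; linarith
      · simp only [h', hi, mt this.2 hi, if_false]; linarith
    have hle' : ∀ i j, G.Adj i j → h' i - h' j ≤ 1 := by
      intro i j hij
      have h1 := hle i j hij
      by_cases hi : i ∈ C <;> by_cases hj : j ∈ C <;> simp only [h', hi, hj, if_true, if_false]
      · linarith
      · have := hmin (i, j) ⟨hij, hi, hj⟩
        simp only at this
        linarith
      · linarith
      · linarith
    have hlt : {e : V × V | G.Adj e.1 e.2 ∧ h' e.1 - h' e.2 ≠ 1}.ncard < n := by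
      rw [← hn]
      refine Set.ncard_lt_ncard ⟨fun e he => ⟨he.1, fun h1 => he.2 (hkeep _ _ he.1 h1)⟩, ?_⟩
        (Set.toFinite _)
      intro hss
      have := hss (show (i₀, j₀) ∈ _ from ⟨hij₀, hne⟩)
      apply this.2
      simp only [h', hi₀, hj₀, if_true, if_false]
      linarith
    obtain ⟨k, hk, hkt⟩ := ih _ hlt h' hle' rfl
    exact ⟨k, hk, fun i j hij h1 => hkt i j hij (hkeep i j hij h1)⟩

end SimpleGraph

/-! ### Facets of the polytope correspond to facet heights -/

section Facets

open SimpleGraph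

variable {V E : Type*} [AddCommGroup E] [Module ℝ E]

/-- The convex hull of the vectors `φ i - φ j` for the edges `{i, j}` of `G`. -/
def edgePolytope (G : SimpleGraph V) (φ : V → E) : Set E :=
  convexHull ℝ {x | ∃ i j : V, G.Adj i j ∧ x = φ i - φ j}

theorem sub_mem_edgePolytope {G : SimpleGraph V} (φ : V → E) {i j : V} (hij : G.Adj i j) :
    φ i - φ j ∈ edgePolytope G φ :=
  subset_convexHull ℝ _ ⟨i, j, hij, rfl⟩

theorem edgePolytope_subset {G : SimpleGraph V} {φ : V → E} {S : Set E} (hS : Convex ℝ S)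
    (h : ∀ i j, G.Adj i j → φ i - φ j ∈ S) : edgePolytope G φ ⊆ S :=
  convexHull_min (by rintro _ ⟨i, j, hij, rfl⟩; exact h i j hij) hS

theorem neg_mem_edgePolytope {G : SimpleGraph V} {φ : V → E} {x : E}
    (hx : x ∈ edgePolytope G φ) : -x ∈ edgePolytope G φ := by
  have : edgePolytope G φ ⊆ -edgePolytope G φ := by
    refine edgePolytope_subset (convex_convexHull ℝ _).neg fun i j hij => ?_
    rw [Set.mem_neg, neg_sub]
    exact sub_mem_edgePolytope φ hij.symm
  exact this hx

variable [TopologicalSpace E]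

theorem map_le_one_of_mem_edgePolytope {G : SimpleGraph V} {φ : V → E} {l : StrongDual ℝ E}
    (hl : ∀ i j, G.Adj i j → l (φ i - φ j) ≤ 1) {x : E} (hx : x ∈ edgePolytope G φ) : l x ≤ 1 :=
  edgePolytope_subset (convex_halfSpace_le l.toLinearMap.isLinear 1) hl hx

/-- If the functional `l'` equals one wherever `l` does among the generators, then the face on
which `l` equals one lies in the face on which `l'` equals one. -/
theorem map_eq_one_of_mem_edgePolytope {G : SimpleGraph V} {φ : V → E} {l l' : StrongDual ℝ E}
    (hl : ∀ i j, G.Adj i j → l (φ i - φ j) ≤ 1)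
    (h : ∀ i j, G.Adj i j → l (φ i - φ j) = 1 → l' (φ i - φ j) = 1)
    {x : E} (hx : x ∈ edgePolytope G φ) (hx1 : l x = 1) : l' x = 1 := by
  -- This set is convex because a proper mixture of two of its points reaches `l = 1` only if both
  -- of them do.
  have hsub : edgePolytope G φ ⊆ {x | l x < 1 ∨ l x = 1 ∧ l' x = 1} := by
    refine edgePolytope_subset ?_ fun i j hij => ?_
    · rintro x hx y hy a b ha hb hab
      have hxle : l x ≤ 1 := hx.elim le_of_lt fun h => h.1.le
      have hyle : l y ≤ 1 := hy.elim le_of_lt fun h => h.1.le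
      simp only [Set.mem_ofPred_eq, map_add, map_smul, smul_eq_mul]
      rcases ha.eq_or_lt with rfl | ha
      · obtain rfl : b = 1 := by linarith
        simpa using hy
      rcases hb.eq_or_lt with rfl | hb
      · obtain rfl : a = 1 := by linarith
        simpa using hx
      rcases hx with hx | ⟨hx, hx'⟩
      · left; nlinarith
      rcases hy with hy | ⟨hy, hy'⟩
      · left; nlinarith
      · right
        rw [hx, hx', hy, hy']
        constructor <;> linarith
    · rcases (hl i j hij).lt_or_eq with h1 | h1
      · exact Or.inl h1
      · exact Or.inr ⟨h1, h i j hij h1⟩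
  rcases hsub hx with h1 | h1
  · exact absurd hx1 h1.ne
  · exact h1.2

/-- The polytope is symmetric about the origin, so a functional whose maximum is not positive
vanishes on it and exposes the whole polytope. For a proper nonempty face the maximum can therefore
be scaled to 1; for the empty face the zero functional serves. -/
theorem exists_functional_of_isExposed {G : SimpleGraph V} {φ : V → E} {B : Set E}
    (hB : IsExposed ℝ (edgePolytope G φ) B) (hne : B ≠ edgePolytope G φ) :
    ∃ l : StrongDual ℝ E, (∀ i j, G.Adj i j → l (φ i - φ j) ≤ 1) ∧
      ∀ x ∈ B, x ∈ edgePolytope G φ ∧ l x = 1 := by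
  rcases B.eq_empty_or_nonempty with rfl | hBne
  · exact ⟨0, by simp, by simp⟩
  obtain ⟨l, hl⟩ := hB hBne
  obtain ⟨x₀, hx₀⟩ := hBne
  have hx₀' := hx₀
  rw [hl] at hx₀'
  obtain ⟨hx₀P, hmax⟩ := hx₀'
  have hpos : 0 < l x₀ := by
    by_contra hneg
    apply hne
    rw [hl]
    refine Set.Subset.antisymm (fun x hx => hx.1) fun x hx => ⟨hx, fun y hy => ?_⟩
    have h1 := hmax y hy
    have h2 := hmax _ (neg_mem_edgePolytope hx)
    rw [map_neg] at h2
    have h3 := hmax _ (neg_mem_edgePolytope hx₀P)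
    rw [map_neg] at h3
    linarith
  refine ⟨(l x₀)⁻¹ • l, fun i j hij => ?_, fun x hx => ?_⟩
  · have := hmax _ (sub_mem_edgePolytope φ hij)
    rw [smul_apply, smul_eq_mul, inv_mul_le_iff₀ hpos]
    linarith
  · rw [hl] at hx
    refine ⟨hx.1, ?_⟩
    have : l x = l x₀ := le_antisymm (hmax x hx.1) (hx.2 x₀ hx₀P)
    rw [smul_apply, smul_eq_mul, this, inv_mul_cancel₀ hpos.ne']

theorem isExposed_setOf_eq_one {G : SimpleGraph V} {φ : V → E} {l : StrongDual ℝ E}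
    (hl : ∀ i j, G.Adj i j → l (φ i - φ j) ≤ 1) :
    IsExposed ℝ (edgePolytope G φ) {x ∈ edgePolytope G φ | l x = 1} := by
  rintro ⟨x₀, hx₀, hx₀1⟩
  refine ⟨l, Set.ext fun x => and_congr_right fun hx => ⟨fun h y hy => ?_, fun h => ?_⟩⟩
  · rw [h]; exact map_le_one_of_mem_edgePolytope hl hy
  · exact le_antisymm (map_le_one_of_mem_edgePolytope hl hx) (hx₀1 ▸ h x₀ hx₀)

/-- The hypothesis on `φ` says that every potential on the vertices comes from a functional, up to a
constant; it is all that the two forms of the polytope need to share. -/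
theorem numFacets_edgePolytope [Finite V] [Nontrivial V] {G : SimpleGraph V} (hG : G.Connected)
    {φ : V → E}
    (hφ : ∀ h : V → ℝ, ∃ l : StrongDual ℝ E, ∀ i j, l (φ i - φ j) = h i - h j) (r : V) :
    numFacets (edgePolytope G φ) = (G.facetHeights r).ncard := by
  choose L hL using fun h : V → ℤ => hφ fun v => (h v : ℝ)
  have hLle : ∀ h ∈ G.facetHeights r, ∀ i j, G.Adj i j → L h (φ i - φ j) ≤ 1 := by
    intro h hh i j hij
    rw [hL]
    exact_mod_cast hh.2.1 i j hij
  let F : (V → ℤ) → Set E := fun h => {x ∈ edgePolytope G φ | L h x = 1}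
  have hF : ∀ h ∈ G.facetHeights r,
      IsExposed ℝ (edgePolytope G φ) (F h) ∧ F h ≠ edgePolytope G φ := by
    refine fun h hh => ⟨isExposed_setOf_eq_one (hLle h hh), fun heq => ?_⟩
    obtain ⟨v, huv⟩ := hG.preconnected.exists_adj_of_nontrivial r
    have h1 := sub_mem_edgePolytope φ huv
    have h2 := neg_mem_edgePolytope h1
    rw [← heq] at h1 h2
    have h3 := h1.2
    have h4 := h2.2
    rw [map_neg, h3] at h4
    norm_num at h4
  -- Inclusion, not only equality, of faces already forces equal heights, since the connected tight
  -- graph of `h` propagates the values from `r`. This gives injectivity and maximality at once.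
  have hFinj : ∀ h ∈ G.facetHeights r, ∀ k ∈ G.facetHeights r, F h ⊆ F k → h = k := by
    intro h hh k hk hsub
    have hstep1 : ∀ i j, G.Adj i j → h i - h j = 1 → k i - k j = 1 := by
      intro i j hij h1
      have hmem : φ i - φ j ∈ F h := ⟨sub_mem_edgePolytope φ hij, by rw [hL]; exact_mod_cast h1⟩
      have := (hsub hmem).2
      rw [hL] at this
      exact_mod_cast this
    have hstep : ∀ i j, (G.tightGraph h).Adj i j → k i - h i = k j - h j := by
      rintro i j ⟨hij, h1⟩
      rcases (abs_eq (zero_le_one' ℤ)).1 h1 with h1 | h1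
      · have := hstep1 i j hij h1
        omega
      · have := hstep1 j i hij.symm (by omega)
        omega
    funext v
    have := eq_of_reachable hstep (hh.2.2.preconnected v r)
    have h0 := hh.1
    have k0 := hk.1
    omega
  have hcover : ∀ B, IsExposed ℝ (edgePolytope G φ) B → B ≠ edgePolytope G φ →
      ∃ k ∈ G.facetHeights r, B ⊆ F k := by
    intro B hB hBne
    obtain ⟨l, hl, hlB⟩ := exists_functional_of_isExposed hB hBne
    obtain ⟨k, hk, htight⟩ := exists_facetHeight_of_le hG r (fun v => l (φ v))
      (fun i j hij => by rw [← map_sub]; exact hl i j hij)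
    refine ⟨k, hk, fun x hx => ⟨(hlB x hx).1, ?_⟩⟩
    refine map_eq_one_of_mem_edgePolytope hl (fun i j hij h1 => ?_) (hlB x hx).1 (hlB x hx).2
    rw [hL]
    rw [map_sub] at h1
    exact_mod_cast htight i j hij h1
  have himage : {B : Set E | IsPolytopeFacet (edgePolytope G φ) B} = F '' G.facetHeights r := by
    ext B
    constructor
    · intro hB
      replace hB : IsPolytopeFacet (edgePolytope G φ) B := hB
      unfold IsPolytopeFacet at hB
      obtain ⟨k, hk, hBk⟩ := hcover B hB.prop.1 hB.prop.2
      exact ⟨k, hk, (hB.eq_of_le (hF k hk) hBk).symm⟩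
    · rintro ⟨h, hh, rfl⟩
      refine ⟨hF h hh, fun B hB hle => ?_⟩
      obtain ⟨k, hk, hBk⟩ := hcover B hB.1 hB.2
      rw [hFinj h hh k hk (hle.trans hBk)]
      exact hBk
  rw [numFacets, himage, Set.InjOn.ncard_image]
  exact fun h hh k hk heq => hFinj h hh k hk heq.subset

variable [Fintype V] [DecidableEq V]

theorem numFacets_adjacencyPolytope [Nontrivial V] {G : SimpleGraph V} (hG : G.Connected) (r : V) :
    numFacets G.adjacencyPolytope = (G.facetHeights r).ncard := by
  refine numFacets_edgePolytope (φ := fun i : V => (Pi.single i 1 : V → ℝ)) hG (fun h => ?_) r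
  refine ⟨∑ v, h v • ContinuousLinearMap.proj v, fun i j => ?_⟩
  rw [map_sub]
  simp [Pi.single_apply]

theorem numFacets_reducedAdjacencyPolytope [Nontrivial V] {G : SimpleGraph V} (hG : G.Connected)
    (s r : V) : numFacets (G.reducedAdjacencyPolytope s) = (G.facetHeights r).ncard := by
  refine numFacets_edgePolytope (φ := fun i : V => reducedBasisVector s i) hG (fun h => ?_) r
  -- Heights are taken relative to `s`, because the basis vector of `s` is zero.
  refine ⟨∑ v : {v : V // v ≠ s}, (h v - h s) • ContinuousLinearMap.proj v, fun i j => ?_⟩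
  have key : ∀ i, (∑ v : {v : V // v ≠ s}, (h v - h s) •
      (ContinuousLinearMap.proj v : StrongDual ℝ ({v : V // v ≠ s} → ℝ)))
        (reducedBasisVector s i) = h i - h s := by
    intro i
    simp only [sum_apply, smul_apply,
      ContinuousLinearMap.proj_apply, reducedBasisVector, smul_eq_mul, mul_ite, mul_one, mul_zero]
    by_cases hi : i = s
    · subst hi
      rw [sub_self]
      exact Finset.sum_eq_zero fun v _ => if_neg v.2
    · rw [Finset.sum_eq_single ⟨i, hi⟩]
      · simp
      · intro v _ hv
        exact if_neg fun h => hv (Subtype.ext h)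
      · simp
  rw [map_sub, key, key]
  ring

end Facets

/-! ### Counting sign sequences with at most one zero -/

open Finset in
open scoped Classical in
/-- The sequences that are `1` or `-1` on `I` and vanish outside of `I`, with the value `1` taken
`j` times. -/
noncomputable def signSequences (I : Finset ℕ) (j : ℕ) : Finset (ℕ → ℤ) :=
  (powersetCard j I).image fun T i => if i ∈ T then 1 else if i ∈ I then -1 else 0

theorem mem_signSequences {I : Finset ℕ} {j : ℕ} {d : ℕ → ℤ} :
    d ∈ signSequences I j ↔
      (∀ i ∈ I, |d i| = 1) ∧ (∀ i ∉ I, d i = 0) ∧ ∑ i ∈ I, d i + I.card = 2 * j := by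
  have hsum : ∀ T ⊆ I, ∑ i ∈ I, (if i ∈ T then (1 : ℤ) else if i ∈ I then -1 else 0) + I.card
      = 2 * T.card := by
    intro T hT
    have h1 : ∀ i ∈ I, (if i ∈ T then (1 : ℤ) else if i ∈ I then -1 else 0)
        = 2 * (if i ∈ T then 1 else 0) - 1 := by
      intro i hi
      split_ifs <;> norm_num
    rw [Finset.sum_congr rfl h1, Finset.sum_sub_distrib, ← Finset.mul_sum, Finset.sum_ite_mem,
      Finset.inter_eq_right.2 hT]
    simp
  simp only [signSequences, Finset.mem_image, Finset.mem_powersetCard]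
  constructor
  · rintro ⟨T, ⟨hT, rfl⟩, rfl⟩
    refine ⟨fun i hi => ?_, fun i hi => ?_, hsum T hT⟩
    · simp only [hi, if_true]
      split_ifs <;> simp
    · simp only [if_neg fun h => hi (hT h), if_neg hi]
  · rintro ⟨h1, h2, h3⟩
    have hd : (fun i => if i ∈ I.filter (fun i => d i = 1) then (1 : ℤ)
        else if i ∈ I then -1 else 0) = d := by
      funext i
      by_cases hi : i ∈ I
      · rcases (abs_eq (zero_le_one' ℤ)).1 (h1 i hi) with h | h <;> simp [hi, h]
      · simp [hi, h2 i hi]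
    refine ⟨I.filter fun i => d i = 1, ⟨Finset.filter_subset _ _, ?_⟩, hd⟩
    have := hsum _ (Finset.filter_subset (fun i => d i = 1) I)
    simp only [funext_iff] at hd
    rw [Finset.sum_congr rfl fun i _ => hd i, h3] at this
    omega

theorem card_signSequences (I : Finset ℕ) (j : ℕ) :
    (signSequences I j).card = I.card.choose j := by
  classical
  rw [signSequences, Finset.card_image_of_injOn, Finset.card_powersetCard]
  intro S hS T hT h
  simp only [Finset.mem_coe, Finset.mem_powersetCard] at hS hT
  ext i
  have := congrFun h i
  simp only at this
  split_ifs at this <;> simp_all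

open scoped Classical in
/-- The sequences that are `1` or `-1` on `{0, …, k - 1}` except for a single zero and vanish
elsewhere, with the value `1` taken `j` times. -/
noncomputable def puncturedSignSequences (k j : ℕ) : Finset (ℕ → ℤ) :=
  (Finset.range k).biUnion fun t => signSequences ((Finset.range k).erase t) j

theorem card_puncturedSignSequences (k j : ℕ) :
    (puncturedSignSequences k j).card = k * (k - 1).choose j := by
  classical
  rw [puncturedSignSequences, Finset.card_biUnion]
  · rw [Finset.sum_congr rfl fun t ht => by
      rw [card_signSequences, Finset.card_erase_of_mem ht, Finset.card_range]]
    simp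
  · intro s hs t ht hst
    rw [Function.onFun, Finset.disjoint_left]
    intro d hd hd'
    have h1 := (mem_signSequences.1 hd).1 t (Finset.mem_erase.2 ⟨hst.symm, ht⟩)
    have h2 := (mem_signSequences.1 hd').2.1 t (Finset.notMem_erase _ _)
    simp [h2] at h1

/-- Each of 0, 1, -1 has the parity of its absolute value. This is the parity argument that
restricts the number of flat edges. -/
theorem exists_sum_eq_card_filter_add {I : Finset ℕ} {d : ℕ → ℤ} (hd : ∀ i ∈ I, |d i| ≤ 1) :
    ∃ z : ℤ, ∑ i ∈ I, d i = (I.filter fun i => d i ≠ 0).card + 2 * z := by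
  have h : ∀ i ∈ I, d i = (if d i ≠ 0 then 1 else 0) + 2 * (if d i = -1 then -1 else 0) := by
    intro i hi
    have := abs_le.1 (hd i hi)
    have h3 : d i = -1 ∨ d i = 0 ∨ d i = 1 := by omega
    rcases h3 with h | h | h <;> simp [h]
  refine ⟨∑ i ∈ I, if d i = -1 then -1 else 0, ?_⟩
  rw [Finset.sum_congr rfl h, Finset.sum_add_distrib, ← Finset.mul_sum, Finset.sum_boole]

theorem mem_signSequences_of_card {k j : ℕ} {d : ℕ → ℤ} (hd : ∀ i < k, |d i| ≤ 1)
    (hd0 : ∀ i, k ≤ i → d i = 0) (hcard : ((Finset.range k).filter fun i => d i ≠ 0).card = k)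
    (hsum : ∑ i ∈ Finset.range k, d i + k = 2 * j) : d ∈ signSequences (Finset.range k) j := by
  have hfil : (Finset.range k).filter (fun i => d i ≠ 0) = Finset.range k :=
    Finset.eq_of_subset_of_card_le (Finset.filter_subset _ _) (by rw [hcard, Finset.card_range])
  refine mem_signSequences.2 ⟨fun i hi => ?_, fun i hi => hd0 i (by simpa using hi),
    by rwa [Finset.card_range]⟩
  have h1 := hd i (Finset.mem_range.1 hi)
  rw [← hfil] at hi
  have h2 := Int.one_le_abs (Finset.mem_filter.1 hi).2
  omega

theorem mem_puncturedSignSequences_of_card {k j : ℕ} {d : ℕ → ℤ} (hd : ∀ i < k, |d i| ≤ 1)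
    (hd0 : ∀ i, k ≤ i → d i = 0)
    (hcard : ((Finset.range k).filter fun i => d i ≠ 0).card + 1 = k)
    (hsum : ∑ i ∈ Finset.range k, d i + k = 2 * j + 1) : d ∈ puncturedSignSequences k j := by
  classical
  have h0 : ((Finset.range k).filter fun i => d i = 0).card = 1 := by
    have := Finset.card_filter_add_card_filter_not (s := Finset.range k) (fun i => d i = 0)
    rw [Finset.card_range] at this
    simp only [ne_eq] at hcard
    omega
  obtain ⟨t, ht⟩ := Finset.card_eq_one.1 h0
  have htmem : t ∈ (Finset.range k).filter fun i => d i = 0 := by rw [ht]; simp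
  obtain ⟨htk, hdt⟩ := Finset.mem_filter.1 htmem
  refine Finset.mem_biUnion.2 ⟨t, htk, mem_signSequences.2 ⟨fun i hi => ?_, fun i hi => ?_, ?_⟩⟩
  · obtain ⟨hit, hik⟩ := Finset.mem_erase.1 hi
    have h1 := hd i (Finset.mem_range.1 hik)
    have h2 : d i ≠ 0 := fun h => hit (by
      have : i ∈ (Finset.range k).filter fun i => d i = 0 := Finset.mem_filter.2 ⟨hik, h⟩
      rw [ht] at this
      simpa using this)
    have := Int.one_le_abs h2
    omega
  · by_cases hit : i = t
    · rw [hit, hdt]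
    · exact hd0 i (by simpa [hit] using hi)
  · rw [← Finset.add_sum_erase _ _ htk, hdt] at hsum
    rw [Finset.card_erase_of_mem htk, Finset.card_range]
    have := Finset.mem_range.1 htk
    omega

theorem signSequences_range_spec {k j : ℕ} {d : ℕ → ℤ}
    (hd : d ∈ signSequences (Finset.range k) j) :
    (∀ i < k, |d i| = 1) ∧ (∀ i, k ≤ i → d i = 0) ∧
      ∑ i ∈ Finset.range k, d i + k = 2 * j := by
  obtain ⟨h1, h2, h3⟩ := mem_signSequences.1 hd
  exact ⟨fun i hi => h1 i (Finset.mem_range.2 hi), fun i hi => h2 i (by simpa using hi),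
    by rwa [Finset.card_range] at h3⟩

theorem puncturedSignSequences_spec {k j : ℕ} {d : ℕ → ℤ}
    (hd : d ∈ puncturedSignSequences k j) :
    (∃ t < k, d t = 0 ∧ ∀ i < k, i ≠ t → |d i| = 1) ∧ (∀ i, k ≤ i → d i = 0) ∧
      ∑ i ∈ Finset.range k, d i + k = 2 * j + 1 := by
  classical
  obtain ⟨t, ht, hd⟩ := Finset.mem_biUnion.1 hd
  obtain ⟨h1, h2, h3⟩ := mem_signSequences.1 hd
  have ht' := Finset.mem_range.1 ht
  have hdt := h2 t (Finset.notMem_erase _ _)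
  refine ⟨⟨t, ht', hdt, fun i hi hit => h1 i (by simp [hi, hit])⟩,
    fun i hi => h2 i (by simp; omega), ?_⟩
  rw [← Finset.add_sum_erase _ _ ht, hdt]
  rw [Finset.card_erase_of_mem ht, Finset.card_range] at h3
  omega

/-! ### Increments of a height along a walk -/

namespace SimpleGraph

section Increments

variable {V : Type*}

/-- The increments of `h` along the first `k` steps of the walk `p`. -/
def increments (h : V → ℤ) (p : ℕ → V) (k : ℕ) : ℕ → ℤ :=
  fun i => if i < k then h (p (i + 1)) - h (p i) else 0

theorem increments_of_lt {h : V → ℤ} {p : ℕ → V} {k i : ℕ} (hi : i < k) :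
    increments h p k i = h (p (i + 1)) - h (p i) :=
  if_pos hi

theorem increments_of_le {h : V → ℤ} {p : ℕ → V} {k i : ℕ} (hi : k ≤ i) :
    increments h p k i = 0 :=
  if_neg hi.not_gt

theorem sum_increments (h : V → ℤ) (p : ℕ → V) {k t : ℕ} (ht : t ≤ k) :
    ∑ i ∈ Finset.range t, increments h p k i = h (p t) - h (p 0) := by
  rw [← Finset.sum_range_sub (fun i => h (p i)) t]
  exact Finset.sum_congr rfl fun i hi =>
    increments_of_lt ((Finset.mem_range.1 hi).trans_le ht)

theorem eq_of_increments_eq {h h' : V → ℤ} {p : ℕ → V} {k : ℕ}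
    (heq : increments h p k = increments h' p k) (h0 : h (p 0) = h' (p 0)) {t : ℕ} (ht : t ≤ k) :
    h (p t) = h' (p t) := by
  have h1 := sum_increments h p ht
  have h2 := sum_increments h' p ht
  rw [heq] at h1
  omega

theorem increments_eq_of_partialSums {h : V → ℤ} {p : ℕ → V} {k : ℕ} {d : ℕ → ℤ}
    (hd : ∀ i, k ≤ i → d i = 0) (hh : ∀ i ≤ k, h (p i) = ∑ t ∈ Finset.range i, d t) :
    increments h p k = d := by
  funext i
  rcases lt_or_ge i k with hi | hi
  · rw [increments_of_lt hi, hh _ hi, hh _ hi.le, Finset.sum_range_succ]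
    ring
  · rw [increments_of_le hi, hd i hi]

open scoped Classical in
/-- The edges of the walk `p` along which `h` is not constant. -/
noncomputable def movingEdges (h : V → ℤ) (p : ℕ → V) (k : ℕ) : Finset (Sym2 V) :=
  ((Finset.range k).filter fun i => increments h p k i ≠ 0).image fun i => s(p i, p (i + 1))

theorem card_movingEdges_le (h : V → ℤ) (p : ℕ → V) (k : ℕ) :
    (movingEdges h p k).card ≤ ((Finset.range k).filter fun i => increments h p k i ≠ 0).card := by
  classical exact Finset.card_image_le

theorem abs_sub_eq_of_sym2_eq {h : V → ℤ} {u v u' v' : V} (he : s(u, v) = s(u', v')) :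
    |h u - h v| = |h u' - h v'| := by
  rcases Sym2.eq_iff.1 he with ⟨rfl, rfl⟩ | ⟨rfl, rfl⟩
  · rfl
  · exact abs_sub_comm _ _

theorem mem_movingEdges {h : V → ℤ} {p : ℕ → V} {k i : ℕ} {u v : V} (hi : i < k)
    (he : s(u, v) = s(p i, p (i + 1))) (huv : |h u - h v| = 1) :
    s(u, v) ∈ movingEdges h p k := by
  classical
  rw [he]
  refine Finset.mem_image.2 ⟨i, Finset.mem_filter.2 ⟨Finset.mem_range.2 hi, ?_⟩, rfl⟩
  rw [increments_of_lt hi]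
  rw [abs_sub_eq_of_sym2_eq he] at huv
  intro h0
  rw [abs_sub_comm, h0] at huv
  simp at huv

/-- A connected graph has at least |V| - 1 edges, so any set that contains all tight edges is at
least that large. -/
theorem card_le_of_tightGraph_connected [Finite V] {G : SimpleGraph V} {h : V → ℤ}
    (hc : (G.tightGraph h).Connected) {S : Finset (Sym2 V)}
    (hS : ∀ u v, G.Adj u v → |h u - h v| = 1 → s(u, v) ∈ S) : Nat.card V ≤ S.card + 1 := by
  refine hc.card_vert_le_card_edgeSet_add_one.trans (Nat.add_le_add_right ?_ 1)
  rw [Nat.card_coe_set_eq, ← Set.ncard_coe_finset]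
  refine Set.ncard_le_ncard (fun e => ?_) (Finset.finite_toSet S)
  induction e with
  | _ u v => exact fun he => hS u v he.1 he.2

/-- Along a walk with at most one step that is not an edge of `T`, every vertex is connected to one
of the ends. -/
theorem reachable_of_walk {T : SimpleGraph V} {p : ℕ → V} {k t : ℕ}
    (hT : ∀ i < k, i ≠ t → T.Adj (p i) (p (i + 1))) {i : ℕ} (hi : i ≤ k) :
    T.Reachable (p 0) (p i) ∨ T.Reachable (p k) (p i) := by
  rcases le_or_gt i t with hit | hit
  · left
    induction i with
    | zero => rfl
    | succ i ih => exact (ih (by omega) (by omega)).trans (hT i hi (by omega)).reachable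
  · right
    -- Past the exceptional step, the induction is on the number of steps left until the end of the
    -- walk.
    obtain ⟨j, rfl⟩ := Nat.exists_eq_add_of_le hi
    clear hi
    induction j with
    | zero => rfl
    | succ j ih =>
      have hadj := hT (i + j) (by omega) (by omega)
      have hpre := ih fun a ha hat => hT a (by omega) hat
      exact hadj.symm.reachable.trans hpre

theorem reachable_ends {T : SimpleGraph V} {p : ℕ → V} {k : ℕ}
    (hT : ∀ i < k, T.Adj (p i) (p (i + 1))) : T.Reachable (p 0) (p k) := by
  induction k with
  | zero => rfl
  | succ k ih => exact (ih fun i hi => hT i (by omega)).trans (hT k (by omega)).reachable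

end Increments

/-! ### Facet heights of an even cycle -/

section Cycle

variable {V : Type*}

/-- `G` is the cycle formed by the path `p 0, …, p k` and the edge that joins its ends. -/
structure IsCycleAlong (G : SimpleGraph V) (p : ℕ → V) (k : ℕ) : Prop where
  inj : ∀ i ≤ k, ∀ j ≤ k, p i = p j → i = j
  surj : ∀ v, ∃ i ≤ k, p i = v
  adj_iff : ∀ u v, G.Adj u v ↔ (∃ i < k, s(u, v) = s(p i, p (i + 1))) ∨ s(u, v) = s(p 0, p k)

namespace IsCycleAlong

variable {G : SimpleGraph V} {p : ℕ → V} {k : ℕ}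

theorem adj_step (H : G.IsCycleAlong p k) {i : ℕ} (hi : i < k) : G.Adj (p i) (p (i + 1)) :=
  (H.adj_iff _ _).2 (Or.inl ⟨i, hi, rfl⟩)

theorem adj_ends (H : G.IsCycleAlong p k) : G.Adj (p 0) (p k) :=
  (H.adj_iff _ _).2 (Or.inr rfl)

theorem connected_of_walk (H : G.IsCycleAlong p k) {T : SimpleGraph V}
    (hT : ∀ i < k, T.Adj (p i) (p (i + 1))) : T.Connected := by
  refine (connected_iff_exists_forall_reachable _).2 ⟨p 0, fun v => ?_⟩
  obtain ⟨i, hi, rfl⟩ := H.surj v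
  exact reachable_ends fun j hj => hT j (hj.trans_le hi)

theorem connected (H : G.IsCycleAlong p k) : G.Connected :=
  H.connected_of_walk fun _ hi => H.adj_step hi

theorem card_le [Finite V] (H : G.IsCycleAlong p k) : k + 1 ≤ Nat.card V := by
  classical
  have := Set.ncard_le_card (((Finset.range (k + 1)).image p : Finset V) : Set V)
  rwa [Set.ncard_coe_finset, Finset.card_image_of_injOn, Finset.card_range] at this
  intro i hi j hj hij
  simp only [Finset.coe_range, Set.mem_Iio] at hi hj
  exact H.inj i (by omega) j (by omega) hij

/-- If the closing edge is flat, the path has an even number of moving steps, hence fewer than the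
odd number `k` that connectedness requires. So the ends differ by ±1, the number of moving steps is
odd and at least `k - 1`, and every step moves. The two alternatives are the two signs. -/
theorem facetHeights_mapsTo [Finite V] (H : G.IsCycleAlong p k) {m : ℕ} (hk : k + 1 = 2 * m)
    {h : V → ℤ} (hh : h ∈ G.facetHeights (p 0)) :
    increments h p k ∈ signSequences (Finset.range k) m ∨
      increments h p k ∈ signSequences (Finset.range k) (m - 1) := by
  classical
  obtain ⟨h0, hle, hc⟩ := hh
  have hd : ∀ i < k, |increments h p k i| ≤ 1 := fun i hi => by
    rw [increments_of_lt hi]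
    have h1 := hle _ _ (H.adj_step hi)
    have h2 := hle _ _ (H.adj_step hi).symm
    exact abs_le.2 ⟨by omega, by omega⟩
  have hsum := sum_increments h p le_rfl (k := k)
  have h1 := hle _ _ H.adj_ends
  have h2 := hle _ _ H.adj_ends.symm
  obtain ⟨z, hz⟩ := exists_sum_eq_card_filter_add (I := Finset.range k)
    fun i hi => hd i (Finset.mem_range.1 hi)
  have hcard := H.card_le.trans (card_le_of_tightGraph_connected hc
    (S := movingEdges h p k ∪ if h (p k) = h (p 0) then ∅ else {s(p 0, p k)}) fun u v huv h1 => by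
      rw [Finset.mem_union]
      rcases (H.adj_iff u v).1 huv with ⟨i, hi, he⟩ | he
      · exact Or.inl (mem_movingEdges hi he h1)
      · right
        rw [abs_sub_eq_of_sym2_eq he] at h1
        rw [if_neg fun h => by simp [h] at h1, he]
        exact Finset.mem_singleton_self _)
  have hunion := Finset.card_union_le (movingEdges h p k)
    (if h (p k) = h (p 0) then ∅ else {s(p 0, p k)})
  have hmov := card_movingEdges_le h p k
  have hfil := Finset.card_filter_le (Finset.range k) fun i => increments h p k i ≠ 0
  rw [Finset.card_range] at hfil
  split_ifs at hcard hunion with hs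
  · rw [Finset.card_empty] at hunion
    omega
  · rw [Finset.card_singleton] at hunion
    have hs' : h (p k) - h (p 0) = 1 ∨ h (p k) - h (p 0) = -1 := by omega
    rcases hs' with hs' | hs'
    · exact Or.inl (mem_signSequences_of_card hd (fun i hi => increments_of_le hi) (by omega)
        (by omega))
    · exact Or.inr (mem_signSequences_of_card hd (fun i hi => increments_of_le hi) (by omega)
        (by omega))

theorem exists_facetHeight (H : G.IsCycleAlong p k) {d : ℕ → ℤ} (hd : ∀ i < k, |d i| = 1)
    (hd0 : ∀ i, k ≤ i → d i = 0) (hs : |∑ i ∈ Finset.range k, d i| ≤ 1) :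
    ∃ h ∈ G.facetHeights (p 0), increments h p k = d := by
  choose f hf hpf using H.surj
  let h : V → ℤ := fun v => ∑ t ∈ Finset.range (f v), d t
  have hh : ∀ i ≤ k, h (p i) = ∑ t ∈ Finset.range i, d t := fun i hi => by
    simp only [h, H.inj _ (hf (p i)) i hi (hpf _)]
  have hstep : ∀ i < k, |h (p i) - h (p (i + 1))| = 1 := fun i hi => by
    rw [hh i hi.le, hh _ hi, Finset.sum_range_succ, sub_add_cancel_left, abs_neg, hd i hi]
  refine ⟨h, ⟨hh 0 (Nat.zero_le _), fun u v huv => ?_, ?_⟩, increments_eq_of_partialSums hd0 hh⟩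
  · refine (le_abs_self _).trans ?_
    rcases (H.adj_iff u v).1 huv with ⟨i, hi, he⟩ | he
    · rw [abs_sub_eq_of_sym2_eq he, hstep i hi]
    · rw [abs_sub_eq_of_sym2_eq he, hh 0 (Nat.zero_le _), hh k le_rfl]
      simpa using hs
  · exact H.connected_of_walk fun i hi => ⟨H.adj_step hi, hstep i hi⟩

theorem ncard_facetHeights [Finite V] (H : G.IsCycleAlong p k) {m : ℕ} (hk : k + 1 = 2 * m) :
    (G.facetHeights (p 0)).ncard = m.centralBinom := by
  classical
  have hinj : Set.InjOn (fun h => increments h p k) (G.facetHeights (p 0)) := by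
    intro h hh h' hh' heq
    funext v
    obtain ⟨i, hi, rfl⟩ := H.surj v
    exact eq_of_increments_eq heq (hh.1.trans hh'.1.symm) hi
  have himg : (fun h => increments h p k) '' G.facetHeights (p 0) =
      ((signSequences (Finset.range k) m ∪ signSequences (Finset.range k) (m - 1) :
        Finset (ℕ → ℤ)) : Set (ℕ → ℤ)) := by
    ext d
    simp only [Set.mem_image, Finset.coe_union, Set.mem_union, Finset.mem_coe]
    constructor
    · rintro ⟨h, hh, rfl⟩
      exact H.facetHeights_mapsTo hk hh
    · rintro (hd | hd) <;> obtain ⟨h1, h2, h3⟩ := signSequences_range_spec hd <;>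
        exact H.exists_facetHeight h1 h2 (abs_le.2 ⟨by omega, by omega⟩)
  rw [← hinj.ncard_image, himg, Set.ncard_coe_finset, Finset.card_union_of_disjoint,
    card_signSequences, card_signSequences, Finset.card_range, Nat.centralBinom, ← hk]
  -- The two signs of the closing edge give the two terms of Pascal's rule.
  · obtain ⟨m, rfl⟩ : ∃ n, m = n + 1 := ⟨m - 1, by omega⟩
    rw [Nat.choose_succ_succ', Nat.add_sub_cancel, add_comm]
  · rw [Finset.disjoint_left]
    intro d hd hd'
    have h1 := (signSequences_range_spec hd).2.2
    have h2 := (signSequences_range_spec hd').2.2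
    omega

end IsCycleAlong

end Cycle

/-! ### Facet heights of two cycles sharing an edge -/

section Theta

variable {V : Type*}

/-- `G` is formed by the paths `p 0, …, p k` and `q 0, …, q l`, which share their ends and nothing
else, and the edge that joins these ends. -/
structure IsThetaAlong (G : SimpleGraph V) (p q : ℕ → V) (k l : ℕ) : Prop where
  inj_left : ∀ i ≤ k, ∀ j ≤ k, p i = p j → i = j
  inj_right : ∀ i ≤ l, ∀ j ≤ l, q i = q j → i = j
  start_eq : p 0 = q 0
  end_eq : p k = q l
  inter : ∀ i ≤ k, ∀ j ≤ l, p i = q j → i = 0 ∧ j = 0 ∨ i = k ∧ j = l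
  surj : ∀ v, (∃ i ≤ k, p i = v) ∨ ∃ j ≤ l, q j = v
  adj_iff : ∀ u v, G.Adj u v ↔ (∃ i < k, s(u, v) = s(p i, p (i + 1))) ∨
    (∃ j < l, s(u, v) = s(q j, q (j + 1))) ∨ s(u, v) = s(p 0, p k)

namespace IsThetaAlong

variable {G : SimpleGraph V} {p q : ℕ → V} {k l : ℕ}

theorem adj_left (H : G.IsThetaAlong p q k l) {i : ℕ} (hi : i < k) : G.Adj (p i) (p (i + 1)) :=
  (H.adj_iff _ _).2 (Or.inl ⟨i, hi, rfl⟩)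

theorem adj_right (H : G.IsThetaAlong p q k l) {j : ℕ} (hj : j < l) : G.Adj (q j) (q (j + 1)) :=
  (H.adj_iff _ _).2 (Or.inr (Or.inl ⟨j, hj, rfl⟩))

theorem adj_ends (H : G.IsThetaAlong p q k l) : G.Adj (p 0) (p k) :=
  (H.adj_iff _ _).2 (Or.inr (Or.inr rfl))

/-- Each path may lose one step, at `t` or `t'`, without cutting a vertex off from both ends; an
index beyond the path means that no step is lost. -/
theorem connected_of_walks (H : G.IsThetaAlong p q k l) {T : SimpleGraph V} {t t' : ℕ}
    (hp : ∀ i < k, i ≠ t → T.Adj (p i) (p (i + 1)))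
    (hq : ∀ j < l, j ≠ t' → T.Adj (q j) (q (j + 1)))
    (he : T.Reachable (p 0) (p k)) : T.Connected := by
  refine (connected_iff_exists_forall_reachable _).2 ⟨p 0, fun v => ?_⟩
  rcases H.surj v with ⟨i, hi, rfl⟩ | ⟨j, hj, rfl⟩
  · exact (reachable_of_walk hp hi).elim id he.trans
  · have := reachable_of_walk hq hj
    rw [← H.start_eq, ← H.end_eq] at this
    exact this.elim id he.trans

theorem connected (H : G.IsThetaAlong p q k l) : G.Connected :=
  H.connected_of_walks (t := k) (t' := l) (fun _ hi _ => H.adj_left hi)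
    (fun _ hj _ => H.adj_right hj) H.adj_ends.reachable

theorem card_le [Finite V] (H : G.IsThetaAlong p q k l) (hl : 1 ≤ l) : k + l ≤ Nat.card V := by
  classical
  -- Only the interior of `q` is added, since its ends already lie on `p`.
  have := Set.ncard_le_card
    (((Finset.range (k + 1)).image p ∪ (Finset.Ico 1 l).image q : Finset V) : Set V)
  rw [Set.ncard_coe_finset, Finset.card_union_of_disjoint, Finset.card_image_of_injOn,
    Finset.card_image_of_injOn, Finset.card_range, Nat.card_Ico] at this
  · omega
  · intro i hi j hj hij
    simp only [Finset.coe_Ico, Set.mem_Ico] at hi hj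
    exact H.inj_right i (by omega) j (by omega) hij
  · intro i hi j hj hij
    simp only [Finset.coe_range, Set.mem_Iio] at hi hj
    exact H.inj_left i (by omega) j (by omega) hij
  · rw [Finset.disjoint_left]
    intro v hv hv'
    obtain ⟨i, hi, rfl⟩ := Finset.mem_image.1 hv
    obtain ⟨j, hj, hij⟩ := Finset.mem_image.1 hv'
    rw [Finset.mem_range] at hi
    rw [Finset.mem_Ico] at hj
    have := H.inter i (by omega) j (by omega) hij.symm
    omega

theorem exists_extension (H : G.IsThetaAlong p q k l) {x y : ℕ → ℤ} (h0 : x 0 = y 0)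
    (hkl : x k = y l) : ∃ h : V → ℤ, (∀ i ≤ k, h (p i) = x i) ∧ ∀ j ≤ l, h (q j) = y j := by
  have key : ∀ v, ∃ z, (∀ i ≤ k, p i = v → z = x i) ∧ ∀ j ≤ l, q j = v → z = y j := by
    have hpq : ∀ i ≤ k, ∀ j ≤ l, p i = q j → x i = y j := by
      intro i hi j hj hij
      rcases H.inter i hi j hj hij with ⟨rfl, rfl⟩ | ⟨rfl, rfl⟩
      · exact h0
      · exact hkl
    intro v
    rcases H.surj v with ⟨i, hi, rfl⟩ | ⟨j, hj, rfl⟩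
    · exact ⟨x i, fun i' hi' h => by rw [H.inj_left i' hi' i hi h],
        fun j hj h => hpq i hi j hj h.symm⟩
    · exact ⟨y j, fun i hi h => (hpq i hi j hj h).symm,
        fun j' hj' h => by rw [H.inj_right j' hj' j hj h]⟩
  choose h hp hq using key
  exact ⟨h, fun i hi => hp _ i hi rfl, fun j hj => hq _ j hj rfl⟩

open scoped Classical in
/-- The pairs of increment sequences of the facet heights on a theta graph. -/
noncomputable def thetaIncrements (k l m₁ m₂ : ℕ) : Finset ((ℕ → ℤ) × (ℕ → ℤ)) :=
  puncturedSignSequences k (m₁ - 1) ×ˢ signSequences (Finset.range l) m₂ ∪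
    (signSequences (Finset.range k) m₁ ×ˢ puncturedSignSequences l m₂ ∪
      signSequences (Finset.range k) (m₁ - 1) ×ˢ puncturedSignSequences l (m₂ - 1))

/-- The three families are disjoint because the first sequence sums to 0, 1 and -1 respectively, the
rise of the height across the shared edge. The hypothesis excludes `m₁ = 0`, where truncated
subtraction would make `m₁ - 1` equal to `m₁`. -/
theorem card_thetaIncrements {k l m₁ m₂ : ℕ} (hk : k + 1 = 2 * m₁) : (thetaIncrements k l m₁ m₂).card =
      k * (k - 1).choose (m₁ - 1) * l.choose m₂ +
        (k.choose m₁ * (l * (l - 1).choose m₂) +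
          k.choose (m₁ - 1) * (l * (l - 1).choose (m₂ - 1))) := by
  classical
  rw [thetaIncrements, Finset.card_union_of_disjoint, Finset.card_union_of_disjoint]
  · simp only [Finset.card_product, card_signSequences, card_puncturedSignSequences,
      Finset.card_range]
  · rw [Finset.disjoint_left]
    rintro ⟨d, d'⟩ h1 h2
    have h3 := (signSequences_range_spec (Finset.mem_product.1 h1).1).2.2
    have h4 := (signSequences_range_spec (Finset.mem_product.1 h2).1).2.2
    simp only at h3 h4
    omega
  · rw [Finset.disjoint_left]
    rintro ⟨d, d'⟩ h1 h2
    have h3 := (puncturedSignSequences_spec (Finset.mem_product.1 h1).1).2.2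
    rcases Finset.mem_union.1 h2 with h2 | h2
    all_goals
      have h4 := (signSequences_range_spec (Finset.mem_product.1 h2).1).2.2
      simp only at h3 h4
      omega

theorem facetHeights_mapsTo [Finite V] (H : G.IsThetaAlong p q k l) {m₁ m₂ : ℕ}
    (hk : k + 1 = 2 * m₁) (hl : l = 2 * m₂) (hm₂ : 1 ≤ m₂)
    {h : V → ℤ} (hh : h ∈ G.facetHeights (p 0)) :
    (increments h p k, increments h q l) ∈ thetaIncrements k l m₁ m₂ := by
  classical
  obtain ⟨h0, hle, hc⟩ := hh
  have hstep : ∀ {u v}, G.Adj u v → |h v - h u| ≤ 1 := fun huv =>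
    abs_le.2 ⟨by have := hle _ _ huv; omega, hle _ _ huv.symm⟩
  have hd : ∀ i < k, |increments h p k i| ≤ 1 := fun i hi => by
    rw [increments_of_lt hi]
    exact hstep (H.adj_left hi)
  have hd' : ∀ j < l, |increments h q l j| ≤ 1 := fun j hj => by
    rw [increments_of_lt hj]
    exact hstep (H.adj_right hj)
  have hsum := sum_increments h p le_rfl (k := k)
  have hsum' := sum_increments h q le_rfl (k := l)
  rw [← H.start_eq, ← H.end_eq] at hsum'
  have hs := abs_le.1 (hstep H.adj_ends)
  obtain ⟨z, hz⟩ := exists_sum_eq_card_filter_add (I := Finset.range k)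
    fun i hi => hd i (Finset.mem_range.1 hi)
  obtain ⟨z', hz'⟩ := exists_sum_eq_card_filter_add (I := Finset.range l)
    fun i hi => hd' i (Finset.mem_range.1 hi)
  have hcard := (H.card_le (by omega)).trans (card_le_of_tightGraph_connected hc
    (S := movingEdges h p k ∪ movingEdges h q l ∪
      if h (p k) = h (p 0) then ∅ else {s(p 0, p k)}) fun u v huv h1 => by
      rw [Finset.mem_union, Finset.mem_union]
      rcases (H.adj_iff u v).1 huv with ⟨i, hi, he⟩ | ⟨j, hj, he⟩ | he
      · exact Or.inl (Or.inl (mem_movingEdges hi he h1))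
      · exact Or.inl (Or.inr (mem_movingEdges hj he h1))
      · right
        rw [abs_sub_eq_of_sym2_eq he] at h1
        rw [if_neg fun h => by simp [h] at h1, he]
        exact Finset.mem_singleton_self _)
  have hunion := Finset.card_union_le (movingEdges h p k ∪ movingEdges h q l)
    (if h (p k) = h (p 0) then ∅ else {s(p 0, p k)})
  have hunion' := Finset.card_union_le (movingEdges h p k) (movingEdges h q l)
  have hmov := card_movingEdges_le h p k
  have hmov' := card_movingEdges_le h q l
  have hfil := Finset.card_filter_le (Finset.range k) fun i => increments h p k i ≠ 0
  have hfil' := Finset.card_filter_le (Finset.range l) fun i => increments h q l i ≠ 0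
  rw [Finset.card_range] at hfil hfil'
  have hz0 : ∀ i, k ≤ i → increments h p k i = 0 := fun i hi => increments_of_le hi
  have hz0' : ∀ i, l ≤ i → increments h q l i = 0 := fun i hi => increments_of_le hi
  simp only [thetaIncrements, Finset.mem_union, Finset.mem_product]
  -- At least `k + l - 1` edges are tight. With the shared edge flat, the odd path has an odd number
  -- of flat steps, hence one, and the even path has none. With the shared edge tight, the odd path
  -- has an even number and the even path an odd number, hence none and one.
  split_ifs at hcard hunion with heq
  · rw [Finset.card_empty] at hunion
    exact Or.inl ⟨mem_puncturedSignSequences_of_card hd hz0 (by omega) (by omega),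
      mem_signSequences_of_card hd' hz0' (by omega) (by omega)⟩
  · rw [Finset.card_singleton] at hunion
    have hs' : h (p k) - h (p 0) = 1 ∨ h (p k) - h (p 0) = -1 := by omega
    rcases hs' with hs' | hs'
    · exact Or.inr (Or.inl ⟨mem_signSequences_of_card hd hz0 (by omega) (by omega),
        mem_puncturedSignSequences_of_card hd' hz0' (by omega) (by omega)⟩)
    · exact Or.inr (Or.inr ⟨mem_signSequences_of_card hd hz0 (by omega) (by omega),
        mem_puncturedSignSequences_of_card hd' hz0' (by omega) (by omega)⟩)

/-- An index `t ≥ k` or `t' ≥ l` encodes a sequence without a zero. The last hypothesis links the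
two ends in the tight graph, by the shared edge or by the whole of `q`; each remaining vertex is
then linked to an end. -/
theorem exists_facetHeight (H : G.IsThetaAlong p q k l) {d d' : ℕ → ℤ} {t t' : ℕ}
    (hd : ∀ i < k, i ≠ t → |d i| = 1) (hdt : t < k → d t = 0) (hd0 : ∀ i, k ≤ i → d i = 0)
    (hd' : ∀ j < l, j ≠ t' → |d' j| = 1) (hdt' : t' < l → d' t' = 0) (hd0' : ∀ j, l ≤ j → d' j = 0)
    (hsum : ∑ i ∈ Finset.range k, d i = ∑ j ∈ Finset.range l, d' j)
    (hs : |∑ i ∈ Finset.range k, d i| ≤ 1)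
    (hor : |∑ i ∈ Finset.range k, d i| = 1 ∨ l ≤ t') :
    ∃ h ∈ G.facetHeights (p 0), (increments h p k, increments h q l) = (d, d') := by
  obtain ⟨h, hp, hq⟩ := H.exists_extension (x := fun i => ∑ a ∈ Finset.range i, d a)
    (y := fun j => ∑ a ∈ Finset.range j, d' a) (by simp) hsum
  have hstep : ∀ i < k, |h (p i) - h (p (i + 1))| = |d i| := fun i hi => by
    rw [hp i hi.le, hp _ hi, Finset.sum_range_succ, sub_add_cancel_left, abs_neg]
  have hstep' : ∀ j < l, |h (q j) - h (q (j + 1))| = |d' j| := fun j hj => by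
    rw [hq j hj.le, hq _ hj, Finset.sum_range_succ, sub_add_cancel_left, abs_neg]
  have hends : |h (p 0) - h (p k)| = |∑ i ∈ Finset.range k, d i| := by
    rw [hp 0 (Nat.zero_le _), hp k le_rfl]
    simp
  refine ⟨h, ⟨hp 0 (Nat.zero_le _), fun u v huv => ?_, ?_⟩,
    Prod.ext (increments_eq_of_partialSums hd0 hp) (increments_eq_of_partialSums hd0' hq)⟩
  · refine (le_abs_self _).trans ?_
    rcases (H.adj_iff u v).1 huv with ⟨i, hi, he⟩ | ⟨j, hj, he⟩ | he
    · rw [abs_sub_eq_of_sym2_eq he, hstep i hi]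
      by_cases hit : i = t
      · subst hit
        simp [hdt hi]
      · exact (hd i hi hit).le
    · rw [abs_sub_eq_of_sym2_eq he, hstep' j hj]
      by_cases hjt : j = t'
      · subst hjt
        simp [hdt' hj]
      · exact (hd' j hj hjt).le
    · rw [abs_sub_eq_of_sym2_eq he, hends]
      exact hs
  · refine H.connected_of_walks (t := t) (t' := t')
      (fun i hi hit => ⟨H.adj_left hi, (hstep i hi).trans (hd i hi hit)⟩)
      (fun j hj hjt => ⟨H.adj_right hj, (hstep' j hj).trans (hd' j hj hjt)⟩) ?_
    rcases hor with h1 | h1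
    · exact Adj.reachable ⟨H.adj_ends, hends.trans h1⟩
    · rw [H.start_eq, H.end_eq]
      exact reachable_ends fun j hj =>
        ⟨H.adj_right hj, (hstep' j hj).trans (hd' j hj (by omega))⟩

theorem ncard_facetHeights [Finite V] (H : G.IsThetaAlong p q k l) {m₁ m₂ : ℕ}
    (hk : k + 1 = 2 * m₁) (hl : l = 2 * m₂) (hm₂ : 1 ≤ m₂) :
    (G.facetHeights (p 0)).ncard = (thetaIncrements k l m₁ m₂).card := by
  classical
  have hinj : Set.InjOn (fun h => (increments h p k, increments h q l))
      (G.facetHeights (p 0)) := by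
    intro h hh h' hh' heq
    obtain ⟨hep, heq⟩ := Prod.ext_iff.1 heq
    have h0 : h (p 0) = h' (p 0) := hh.1.trans hh'.1.symm
    funext v
    rcases H.surj v with ⟨i, hi, rfl⟩ | ⟨j, hj, rfl⟩
    · exact eq_of_increments_eq hep h0 hi
    · rw [H.start_eq] at h0
      exact eq_of_increments_eq heq h0 hj
  have himg : (fun h => (increments h p k, increments h q l)) '' G.facetHeights (p 0) =
      (thetaIncrements k l m₁ m₂ : Set ((ℕ → ℤ) × (ℕ → ℤ))) := by
    refine Set.Subset.antisymm ?_ ?_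
    · rintro _ ⟨h, hh, rfl⟩
      exact H.facetHeights_mapsTo hk hl hm₂ hh
    · rintro ⟨d, d'⟩ hd
      simp only [thetaIncrements, Finset.coe_union, Set.mem_union, Finset.mem_coe,
        Finset.mem_product] at hd
      rcases hd with ⟨hd, hd'⟩ | ⟨hd, hd'⟩ | ⟨hd, hd'⟩
      · obtain ⟨⟨t, ht, hdt, h1⟩, h2, h3⟩ := puncturedSignSequences_spec hd
        obtain ⟨h1', h2', h3'⟩ := signSequences_range_spec hd'
        exact H.exists_facetHeight h1 (fun _ => hdt) h2 (t' := l) (fun j hj _ => h1' j hj)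
          (fun h => absurd h (lt_irrefl _)) h2' (by omega) (abs_le.2 ⟨by omega, by omega⟩)
          (Or.inr le_rfl)
      all_goals
        obtain ⟨⟨t, ht, hdt, h1'⟩, h2', h3'⟩ := puncturedSignSequences_spec hd'
        obtain ⟨h1, h2, h3⟩ := signSequences_range_spec hd
        exact H.exists_facetHeight (t := k) (fun i hi _ => h1 i hi)
          (fun h => absurd h (lt_irrefl _)) h2 h1' (fun _ => hdt) h2' (by omega)
          (abs_le.2 ⟨by omega, by omega⟩)
          (Or.inl ((abs_eq (zero_le_one' ℤ)).2 (by omega)))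
  rw [← hinj.ncard_image, himg, Set.ncard_coe_finset]

end IsThetaAlong

end Theta

end SimpleGraph

/-! ### Parametrizing the given graphs and evaluating the count -/

namespace SimpleGraph

/-- The path leaves `a` in the direction away from `b`, with step `e = a - b = ±1`, and goes round
the cycle to `b`. Since `e * e = 1`, the vertex `v` is met at the index representing `e * (v - a)`.
-/
theorem exists_isCycleAlong_of_zmod {N : ℕ} (hN : 2 ≤ N) {G : SimpleGraph (ZMod N)}
    (hG : ∀ u v, G.Adj u v ↔ u - v = 1 ∨ v - u = 1) {a b : ZMod N} (hab : G.Adj a b) :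
    ∃ p : ℕ → ZMod N, G.IsCycleAlong p (N - 1) ∧ p 0 = a ∧ p (N - 1) = b := by
  have : NeZero N := ⟨by omega⟩
  obtain ⟨e, he, hb⟩ : ∃ e : ZMod N, (e = 1 ∨ e = -1) ∧ b = a - e := by
    rcases (hG a b).1 hab with h | h
    · exact ⟨1, Or.inl rfl, by rw [← h]; ring⟩
    · exact ⟨-1, Or.inr rfl, by rw [← h]; ring⟩
  have hee : e * e = 1 := by rcases he with rfl | rfl <;> ring
  have hG' : ∀ u v, G.Adj u v ↔ v - u = e ∨ u - v = e := by
    intro u v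
    rw [hG]
    rcases he with rfl | rfl
    · exact or_comm
    · rw [eq_neg_iff_add_eq_zero, eq_neg_iff_add_eq_zero, ← sub_eq_zero (b := (1 : ZMod N)),
        ← sub_eq_zero (b := (1 : ZMod N)), ← neg_eq_zero (a := u - v - 1),
        ← neg_eq_zero (a := v - u - 1)]
      ring_nf
  have hlast : ((N - 1 : ℕ) : ZMod N) = -1 := by
    rw [Nat.cast_sub (by omega), ZMod.natCast_self]
    simp
  let p : ℕ → ZMod N := fun i => a + e * i
  have hp0 : p 0 = a := by simp [p]
  have hpk : p (N - 1) = b := by simp only [p, hlast, hb]; ring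
  have hsucc : ∀ i, p (i + 1) = p i + e := fun i => by simp only [p]; push_cast; ring
  have hclose : p 0 = p (N - 1) + e := by rw [hp0, hpk, hb]; ring
  have hsurj : ∀ v, ∃ i ≤ N - 1, p i = v := fun v => by
    refine ⟨(e * (v - a)).val, Nat.le_sub_one_of_lt (ZMod.val_lt _), ?_⟩
    simp only [p, ZMod.natCast_zmod_val]
    rw [← mul_assoc, hee]
    ring
  have hnext : ∀ u v, v - u = e →
      (∃ i < N - 1, s(u, v) = s(p i, p (i + 1))) ∨ s(u, v) = s(p 0, p (N - 1)) := by
    intro u v huv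
    obtain ⟨i, hi, rfl⟩ := hsurj u
    have hv : v = p i + e := by rw [← huv]; ring
    rcases hi.lt_or_eq with hi | rfl
    · exact Or.inl ⟨i, hi, by rw [hv, hsucc]⟩
    · exact Or.inr (by rw [hv, ← hclose, Sym2.eq_swap])
  refine ⟨p, ⟨fun i hi j hj hij => ?_, hsurj, fun u v => ⟨fun huv => ?_, ?_⟩⟩, hp0, hpk⟩
  · have h1 : (i : ZMod N) = j := by
      have h2 : e * (e * i) = e * (e * (j : ZMod N)) := congrArg (e * ·) (add_left_cancel hij)
      rwa [← mul_assoc, ← mul_assoc, hee, one_mul, one_mul] at h2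
    have h3 := (ZMod.natCast_eq_natCast_iff' i j N).1 h1
    rwa [Nat.mod_eq_of_lt (by omega), Nat.mod_eq_of_lt (by omega)] at h3
  · rcases (hG' u v).1 huv with h | h
    · exact hnext u v h
    · rw [Sym2.eq_swap]
      exact hnext v u h
  · have hadj : ∀ i, G.Adj (p i) (p (i + 1)) := fun i =>
      (hG' _ _).2 (Or.inl (by rw [hsucc]; ring))
    have hadj' : G.Adj (p 0) (p (N - 1)) := (hG' _ _).2 (Or.inr (by rw [hclose]; ring))
    rintro (⟨i, -, h⟩ | h)
    · rw [← mem_edgeSet, h]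
      exact hadj i
    · rw [← mem_edgeSet, h]
      exact hadj'

theorem exists_isCycleAlong_cycleGraph {N : ℕ} (hN : 2 ≤ N) {a b : Fin N}
    (hab : (cycleGraph N).Adj a b) :
    ∃ p : ℕ → Fin N, (cycleGraph N).IsCycleAlong p (N - 1) ∧ p 0 = a ∧ p (N - 1) = b := by
  obtain ⟨n, rfl⟩ : ∃ n, N = n + 2 := ⟨N - 2, by omega⟩
  -- `ZMod (n + 2)` is by definition `Fin (n + 2)`.
  exact exists_isCycleAlong_of_zmod (N := n + 2) hN (fun _ _ => Iff.rfl) hab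

/-- Both cycles are parametrized from one shared vertex to the other, so that the shared edge closes
each of them and what remains are the two paths. -/
theorem IsEdgeJoin.exists_isThetaAlong {V : Type*} {G : SimpleGraph V} {M N : ℕ} (hM : 2 ≤ M)
    (hN : 2 ≤ N) (hG : G.IsEdgeJoin (cycleGraph M) (cycleGraph N)) :
    ∃ p q : ℕ → V, G.IsThetaAlong p q (M - 1) (N - 1) := by
  obtain ⟨f, g, a, b, c, d, hab, hcd, hac, hbd, hinter, hunion, rfl⟩ := hG
  obtain ⟨p, hp, rfl, rfl⟩ := exists_isCycleAlong_cycleGraph hM hab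
  obtain ⟨q, hq, rfl, rfl⟩ := exists_isCycleAlong_cycleGraph hN hcd
  refine ⟨fun i => f (p i), fun j => g (q j), ?_⟩
  have hmap : ∀ {W : Type} {H : SimpleGraph W} {w : ℕ → W} {n : ℕ} (φ : W ↪ V),
      H.IsCycleAlong w n → ∀ u v, (H.map φ).Adj u v ↔
        (∃ i < n, s(u, v) = s(φ (w i), φ (w (i + 1)))) ∨ s(u, v) = s(φ (w 0), φ (w n)) := by
    intro W H w n φ hw u v
    rw [map_adj]
    constructor
    · rintro ⟨u, v, huv, rfl, rfl⟩
      rcases (hw.adj_iff u v).1 huv with ⟨i, hi, h⟩ | h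
      · exact Or.inl ⟨i, hi, congrArg (Sym2.map φ) h⟩
      · exact Or.inr (congrArg (Sym2.map φ) h)
    · have hback : ∀ x y, H.Adj x y → s(u, v) = s(φ x, φ y) →
          ∃ u' v', H.Adj u' v' ∧ φ u' = u ∧ φ v' = v := by
        intro x y hxy h
        rcases Sym2.eq_iff.1 h with ⟨rfl, rfl⟩ | ⟨rfl, rfl⟩
        · exact ⟨x, y, hxy, rfl, rfl⟩
        · exact ⟨y, x, hxy.symm, rfl, rfl⟩
      rintro (⟨i, hi, h⟩ | h)
      · exact hback _ _ (hw.adj_step hi) h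
      · exact hback _ _ hw.adj_ends h
  refine ⟨fun i hi j hj h => hp.inj i hi j hj (f.injective h),
    fun i hi j hj h => hq.inj i hi j hj (g.injective h), hac, hbd, fun i hi j hj h => ?_,
    fun v => ?_, fun u v => ?_⟩
  · have hmem : f (p i) ∈ Set.range f ∩ Set.range g := ⟨⟨_, rfl⟩, ⟨_, h.symm⟩⟩
    rw [hinter] at hmem
    rcases hmem with h' | h'
    · left
      exact ⟨hp.inj i hi 0 (Nat.zero_le _) (f.injective h'),
        hq.inj j hj 0 (Nat.zero_le _) (g.injective (h.symm.trans (h'.trans hac)))⟩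
    · right
      exact ⟨hp.inj i hi _ le_rfl (f.injective h'),
        hq.inj j hj _ le_rfl (g.injective (h.symm.trans (h'.trans hbd)))⟩
  · have hv : v ∈ Set.range f ∪ Set.range g := hunion ▸ Set.mem_univ v
    rcases hv with ⟨x, rfl⟩ | ⟨y, rfl⟩
    · obtain ⟨i, hi, rfl⟩ := hp.surj x
      exact Or.inl ⟨i, hi, rfl⟩
    · obtain ⟨j, hj, rfl⟩ := hq.surj y
      exact Or.inr ⟨j, hj, rfl⟩
  · rw [sup_adj, hmap f hp, hmap g hq, ← hac, ← hbd]
    -- The shared edge occurs in both copies and is merged into one alternative.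
    rw [← or_assoc, ← or_assoc, or_right_comm, or_assoc (c := s(u, v) = _), or_self,
      or_right_comm]

theorem cycleGraph_isCycleAlong {N : ℕ} (hN : 2 ≤ N) :
    ∃ p : ℕ → Fin N, (cycleGraph N).IsCycleAlong p (N - 1) := by
  obtain ⟨n, rfl⟩ : ∃ n, N = n + 2 := ⟨N - 2, by omega⟩
  obtain ⟨p, hp, -⟩ := exists_isCycleAlong_cycleGraph hN (a := 1) (b := 0)
    (cycleGraph_adj.2 (Or.inl (sub_zero 1)))
  exact ⟨p, hp⟩

theorem numFacets_cycleGraph {m : ℕ} (hm : 1 ≤ m) :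
    numFacets (cycleGraph (2 * m)).adjacencyPolytope = m.centralBinom ∧
      ∀ r, numFacets ((cycleGraph (2 * m)).reducedAdjacencyPolytope r) = m.centralBinom := by
  obtain ⟨p, hp⟩ := cycleGraph_isCycleAlong (N := 2 * m) (by omega)
  have : Nontrivial (Fin (2 * m)) := Fin.nontrivial_iff_two_le.2 (by omega)
  have hcard := hp.ncard_facetHeights (m := m) (by omega)
  exact ⟨by rw [numFacets_adjacencyPolytope hp.connected (p 0), hcard],
    fun r => by rw [numFacets_reducedAdjacencyPolytope hp.connected r (p 0), hcard]⟩

/-- A central binomial coefficient is twice the middle one in the row above, which turns the last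
two summands into the `m₂` term; the recursion `(a + 1) C(2a + 2, a + 1) = 2 (2a + 1) C(2a, a)`
turns the first into the `m₁` term. -/
theorem card_thetaIncrements_eq {m₁ m₂ : ℕ} (hm₁ : 1 ≤ m₁) (hm₂ : 1 ≤ m₂) :
    ((IsThetaAlong.thetaIncrements (2 * m₁ - 1) (2 * m₂) m₁ m₂).card : ℚ) =
      ((m₁ : ℚ) + 2 * m₂) / 2 * m₁.centralBinom * m₂.centralBinom := by
  rw [IsThetaAlong.card_thetaIncrements (by omega)]
  obtain ⟨a, rfl⟩ : ∃ a, m₁ = a + 1 := ⟨m₁ - 1, by omega⟩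
  obtain ⟨b, rfl⟩ : ∃ b, m₂ = b + 1 := ⟨m₂ - 1, by omega⟩
  have e1 : 2 * (a + 1) - 1 = 2 * a + 1 := by omega
  have e2 : 2 * (b + 1) - 1 = 2 * b + 1 := by omega
  have hhalf : ∀ n, (2 * n + 1).choose n = (2 * n + 1).choose (n + 1) := fun n =>
    Nat.choose_symm_half n |>.symm
  have hpas : ∀ n, (n + 1).centralBinom = 2 * (2 * n + 1).choose (n + 1) := fun n => by
    rw [Nat.centralBinom, show 2 * (n + 1) = 2 * n + 1 + 1 by ring, Nat.choose_succ_succ', hhalf]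
    ring
  have hrec := Nat.succ_mul_centralBinom_succ a
  have hmid' : (2 * (b + 1)).choose (b + 1) = (b + 1).centralBinom := rfl
  simp only [e1, e2, Nat.add_sub_cancel]
  rw [hmid', hhalf a, hhalf b,
    show (2 * a).choose a = a.centralBinom from rfl]
  have ha : (((a + 1).centralBinom : ℕ) : ℚ) = 2 * (2 * a + 1).choose (a + 1) := by
    exact_mod_cast hpas a
  have hb : (((b + 1).centralBinom : ℕ) : ℚ) = 2 * (2 * b + 1).choose (b + 1) := by
    exact_mod_cast hpas b
  have hr : ((a : ℚ) + 1) * (a + 1).centralBinom = 2 * (2 * a + 1) * a.centralBinom := by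
    exact_mod_cast hrec
  push_cast
  linear_combination (-(b + 1).centralBinom / 2 : ℚ) * hr
    - (b + 1 : ℚ) * (b + 1).centralBinom * ha
    - 2 * (b + 1 : ℚ) * (2 * a + 1).choose (a + 1) * hb

end SimpleGraph

theorem mainTheorem12 {V : Type*} [Fintype V] [DecidableEq V] (G : SimpleGraph V)
    (m₁ m₂ : ℕ) (hm₁ : 2 ≤ m₁) (hm₂ : 1 ≤ m₂)
    (hG : G.IsEdgeJoin (SimpleGraph.cycleGraph (2 * m₁)) (SimpleGraph.cycleGraph (2 * m₂ + 1))) :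
    (numFacets G.adjacencyPolytope : ℚ) =
        ((m₁ : ℚ) + 2 * (m₂ : ℚ)) / 2
          * (numFacets (SimpleGraph.cycleGraph (2 * m₁)).adjacencyPolytope : ℚ)
          * (numFacets (SimpleGraph.cycleGraph (2 * m₂)).adjacencyPolytope : ℚ) ∧
      ∀ (r : V) (r₁ : Fin (2 * m₁)) (r₂ : Fin (2 * m₂)),
        (numFacets (G.reducedAdjacencyPolytope r) : ℚ) =
          ((m₁ : ℚ) + 2 * (m₂ : ℚ)) / 2
            * (numFacets ((SimpleGraph.cycleGraph (2 * m₁)).reducedAdjacencyPolytope r₁) : ℚ)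
            * (numFacets ((SimpleGraph.cycleGraph (2 * m₂)).reducedAdjacencyPolytope r₂) : ℚ) := by
  obtain ⟨p, q, h⟩ := hG.exists_isThetaAlong (by omega) (by omega)
  rw [Nat.add_sub_cancel] at h
  obtain ⟨hc₁, hr₁⟩ := SimpleGraph.numFacets_cycleGraph (m := m₁) (by omega)
  obtain ⟨hc₂, hr₂⟩ := SimpleGraph.numFacets_cycleGraph hm₂
  have : Nontrivial V := ⟨_, _, h.adj_ends.ne⟩
  have hcard : ((G.facetHeights (p 0)).ncard : ℚ) =
      ((m₁ : ℚ) + 2 * m₂) / 2 * m₁.centralBinom * m₂.centralBinom := by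
    rw [h.ncard_facetHeights (m₁ := m₁) (by omega) rfl hm₂,
      SimpleGraph.card_thetaIncrements_eq (by omega) hm₂]
  refine ⟨?_, fun r r₁ r₂ => ?_⟩
  · rw [numFacets_adjacencyPolytope h.connected (p 0), hcard, hc₁, hc₂]
  · rw [numFacets_reducedAdjacencyPolytope h.connected r (p 0), hcard, hr₁, hr₂]
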